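/- Let $P_2^r(\mathbb{R}^d)$ be the set of Borel probability measures $\mu$ on $\mathbb{R}^d$ with $\int\|x\|^2\,d\mu(x)<\infty$ that are absolutely continuous with respect to Lebesgue measure. A Borel probability measure $\mu$ on $\mathbb{R}^d$ is a probabilistic frame if there exist $0<A\le B<\infty$ such that $A\|x\|^2\le\int\langle x,y\rangle^2\,d\mu(y)\le B\|x\|^2$ for all $x\in\mathbb{R}^d$. Write $\operatorname{supp}(\mu)$ for the set of points all of whose open neighbourhoods have positive $\mu$-measure. Let $\mu,\nu\in P_2^r(\mathbb{R}^d)$ and let $r:\mathbb{R}^d\to\mathbb{R}^d$ be the optimal transport map from $\mu$ to $\nu$ for the $2$-Wasserstein distance; that is, $r_\#\mu=\nu$, and $(\mathrm{id},r)_\#\mu$ minimizes $\iint\|x-y\|^2\,d\gamma(x,y)$ among all probability measures $\gamma$ on $\mathbb{R}^d\times\mathbb{R}^d$ with marginals $\mu$ and $\nu$. For $t\in[0,1]$ put $h_t(x)=(1-t)x+t\,r(x)$ and $\mu_t=(h_t)_\#\mu$. Let $N\subset\mathbb{R}^d$ be any set with $\mu(N)=0$; in particular, $N$ may be a $\mu$-null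 set such that $h_t$ is injective on $\operatorname{supp}(\mu)\setminus N$ for every $t\in[0,1]$. Suppose that $r$ is continuous on $\operatorname{supp}(\mu)\setminus N$ (for example, continuous on $\mathbb{R}^d$), and that $\operatorname{supp}(\mu)\setminus N$ contains a nonempty open set. Then for every $t\in[0,1]$ the measure $\mu_t$ on the Wasserstein geodesic from $\mu$ to $\nu$ is a probabilistic frame, and the linear span of $\operatorname{supp}(\mu_t)$ is $\mathbb{R}^d$. -/

import Mathlib

open MeasureTheory Set
open scoped ENNReal

/-- `P₂(ℝᵈ)` restricted to regular measures: probability measures on `ℝᵈ` with finite second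
moment that are absolutely continuous with respect to Lebesgue measure. -/
structure IsRegularP2 {d : ℕ} (μ : Measure (EuclideanSpace ℝ (Fin d))) : Prop where
  isProbabilityMeasure : IsProbabilityMeasure μ
  secondMoment_lt_top : ∫⁻ x, ‖x‖ₑ ^ 2 ∂μ < ∞
  absolutelyContinuous : μ ≪ volume

/-- `μ` is a probabilistic frame: a probability measure for which there are `0 < A ≤ B < ∞` with
`A ‖x‖² ≤ ∫ ⟨x, y⟩² dμ(y) ≤ B ‖x‖²` for all `x`. The integral is the Lebesgue integral of a
nonnegative function, with values in `[0, ∞]`. -/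
def IsProbabilisticFrame {d : ℕ} (μ : Measure (EuclideanSpace ℝ (Fin d))) : Prop :=
  IsProbabilityMeasure μ ∧ ∃ A B : ℝ, 0 < A ∧ A ≤ B ∧
    ∀ x : EuclideanSpace ℝ (Fin d),
      ENNReal.ofReal (A * ‖x‖ ^ 2) ≤ ∫⁻ y, ENNReal.ofReal ((inner ℝ x y) ^ 2) ∂μ ∧
      ∫⁻ y, ENNReal.ofReal ((inner ℝ x y) ^ 2) ∂μ ≤ ENNReal.ofReal (B * ‖x‖ ^ 2)

/-- `Γ(μ, ν)`: the joint probability measures on `ℝᵈ × ℝᵈ` with marginals `μ` and `ν`. -/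
def transportPlans {d : ℕ} (μ ν : Measure (EuclideanSpace ℝ (Fin d))) :
    Set (Measure (EuclideanSpace ℝ (Fin d) × EuclideanSpace ℝ (Fin d))) :=
  {γ | IsProbabilityMeasure γ ∧ γ.map Prod.fst = μ ∧ γ.map Prod.snd = ν}

/-- The quadratic transport cost `∬ ‖x - y‖² dγ(x, y)`. -/
noncomputable def quadraticCost {d : ℕ}
    (γ : Measure (EuclideanSpace ℝ (Fin d) × EuclideanSpace ℝ (Fin d))) : ℝ≥0∞ :=
  ∫⁻ p, ‖p.1 - p.2‖ₑ ^ 2 ∂γ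

/-- The squared 2-Wasserstein distance `W₂²(μ, ν)`. -/
noncomputable def wassersteinSq {d : ℕ} (μ ν : Measure (EuclideanSpace ℝ (Fin d))) : ℝ≥0∞ :=
  ⨅ γ ∈ transportPlans μ ν, quadraticCost γ

/-- `γ` is an optimal transport plan between `μ` and `ν` for the 2-Wasserstein distance. -/
def IsOptimalPlan {d : ℕ} (μ ν : Measure (EuclideanSpace ℝ (Fin d)))
    (γ : Measure (EuclideanSpace ℝ (Fin d) × EuclideanSpace ℝ (Fin d))) : Prop :=
  γ ∈ transportPlans μ ν ∧ quadraticCost γ = wassersteinSq μ ν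

/-- `r` is an optimal transport map from `μ` to `ν` for the 2-Wasserstein distance: it pushes
`μ` to `ν`, and the plan `(id, r)_# μ` which it induces is optimal. -/
def IsOptimalMap {d : ℕ} (μ ν : Measure (EuclideanSpace ℝ (Fin d)))
    (r : EuclideanSpace ℝ (Fin d) → EuclideanSpace ℝ (Fin d)) : Prop :=
  AEMeasurable r μ ∧ μ.map r = ν ∧ IsOptimalPlan μ ν (μ.map fun x => (x, r x))

/-- The interpolation `h_t(x) = (1 - t) x + t r(x)`. -/
def interpMap {d : ℕ} (r : EuclideanSpace ℝ (Fin d) → EuclideanSpace ℝ (Fin d)) (t : ℝ)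
    (x : EuclideanSpace ℝ (Fin d)) : EuclideanSpace ℝ (Fin d) :=
  (1 - t) • x + t • r x

/-- The measure `μ_t = (h_t)_# μ` on the Wasserstein geodesic determined by `r`. -/
noncomputable def geodesicMeasure {d : ℕ} (μ : Measure (EuclideanSpace ℝ (Fin d)))
    (r : EuclideanSpace ℝ (Fin d) → EuclideanSpace ℝ (Fin d)) (t : ℝ) :
    Measure (EuclideanSpace ℝ (Fin d)) :=
  μ.map (interpMap r t)

/-! ### Exchanging targets and monotonicity of optimal maps -/

section Swap

variable {d : ℕ} {μ ν : Measure (EuclideanSpace ℝ (Fin d))}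
  {r : EuclideanSpace ℝ (Fin d) → EuclideanSpace ℝ (Fin d)}

/-! Both conclusions follow once no hyperplane `xᗮ` carries `μ_t`. At `t = 1` this is absolute
continuity of `ν`. For `t < 1`, if `⟨x, h_t⟩` vanished `μ`-a.e., it would by continuity vanish on
all of an open `U` in the support. Moving from `w` to `w + s • x` inside `U` would then force `t ⟨x,
r (w + s • x) - r w⟩ = -(1 - t) s ‖x‖² < 0`, against monotonicity of `r` on `U`
(`IsOptimalMap.inner_sub_nonneg`). Monotonicity comes directly from optimality: if it failed at two
points, exchanging targets between small neighbourhoods of them would lower the cost. -/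

lemma quadraticCost_map {α : Type*} [MeasurableSpace α] {m : Measure α}
    {g : α → EuclideanSpace ℝ (Fin d) × EuclideanSpace ℝ (Fin d)} (hg : AEMeasurable g m) :
    quadraticCost (m.map g) = ∫⁻ a, ‖(g a).1 - (g a).2‖ₑ ^ 2 ∂m := by
  unfold quadraticCost
  rw [lintegral_map' (by fun_prop) hg]

lemma IsRegularP2.memLp_id (hμ : IsRegularP2 μ) : MemLp (fun x => x) 2 μ := by
  refine ⟨aestronglyMeasurable_id, ?_⟩
  rw [eLpNorm_lt_top_iff_lintegral_rpow_enorm_lt_top two_ne_zero ENNReal.ofNat_ne_top]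
  simpa using hμ.secondMoment_lt_top

lemma quadraticCost_map_prodMk_ne_top (hid : MemLp (fun x => x) 2 μ) (hr : MemLp r 2 μ) :
    quadraticCost (μ.map fun x => (x, r x)) ≠ ∞ := by
  have hm := hr.aestronglyMeasurable.aemeasurable
  rw [quadraticCost_map (by fun_prop)]
  have h := (hid.sub hr).2
  rw [eLpNorm_lt_top_iff_lintegral_rpow_enorm_lt_top two_ne_zero ENNReal.ofNat_ne_top] at h
  simpa using h.ne

lemma lintegral_displacement_ne_top (hm : AEMeasurable r μ)
    (hfin : quadraticCost (μ.map fun x => (x, r x)) ≠ ∞) {α : Type*} [MeasurableSpace α]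
    {κ : Measure α} {f : α → EuclideanSpace ℝ (Fin d)} (hf : Measurable f) (hκ : κ.map f ≤ μ) :
    ∫⁻ a, ‖f a - r (f a)‖ₑ ^ 2 ∂κ ≠ ∞ := by
  have hmκ := hm.mono_measure hκ
  rw [quadraticCost_map (by fun_prop)] at hfin
  rw [← lintegral_map' (f := fun x => ‖x - r x‖ₑ ^ 2) (by fun_prop) hf.aemeasurable]
  exact ne_top_of_le_ne_top hfin (lintegral_mono' hκ le_rfl)

/-- Rerouting a subplan of pairs of source points, so that they exchange their targets, does not
lower the cost of an optimal map. -/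
lemma IsOptimalMap.lintegral_le_lintegral_swap_of_measurable [IsProbabilityMeasure μ]
    (hr : IsOptimalMap μ ν r) (hm : Measurable r)
    (hfin : quadraticCost (μ.map fun x => (x, r x)) ≠ ∞)
    {κ : Measure (EuclideanSpace ℝ (Fin d) × EuclideanSpace ℝ (Fin d))} [IsFiniteMeasure κ]
    (hκ : κ.map Prod.fst + κ.map Prod.snd ≤ μ) :
    ∫⁻ p, (‖p.1 - r p.1‖ₑ ^ 2 + ‖p.2 - r p.2‖ₑ ^ 2) ∂κ ≤
      ∫⁻ p, (‖p.1 - r p.2‖ₑ ^ 2 + ‖p.2 - r p.1‖ₑ ^ 2) ∂κ := by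
  obtain ⟨-, hmap, -, hcost⟩ := hr
  have hμ := Measure.sub_add_cancel_of_le hκ
  set ρ := μ - (κ.map Prod.fst + κ.map Prod.snd)
  -- The competitor: mass outside `κ` stays on the graph of `r`, and each pair drawn from `κ`
  -- exchanges its images.
  let γ : Measure (EuclideanSpace ℝ (Fin d) × EuclideanSpace ℝ (Fin d)) :=
    ρ.map (fun x => (x, r x)) +
      (κ.map (fun p => (p.1, r p.2)) + κ.map (fun p => (p.2, r p.1)))
  have hfst : γ.map Prod.fst = μ := by
    rw [Measure.map_add _ _ measurable_fst, Measure.map_add _ _ measurable_fst,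
      Measure.map_map measurable_fst (by fun_prop), Measure.map_map measurable_fst (by fun_prop),
      Measure.map_map measurable_fst (by fun_prop)]
    refine Eq.trans ?_ hμ
    congr 1
    exact Measure.map_id
  have hsnd : γ.map Prod.snd = ν := by
    rw [← hmap, ← hμ, Measure.map_add _ _ hm, Measure.map_add _ _ hm,
      Measure.map_map hm measurable_fst, Measure.map_map hm measurable_snd,
      Measure.map_add _ _ measurable_snd, Measure.map_add _ _ measurable_snd,
      Measure.map_map measurable_snd (by fun_prop), Measure.map_map measurable_snd (by fun_prop),
      Measure.map_map measurable_snd (by fun_prop), add_comm (κ.map (r ∘ Prod.fst))]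
    rfl
  have hprob : IsProbabilityMeasure γ := by
    have h1 : γ.map Prod.fst univ = 1 := by rw [hfst, measure_univ]
    rw [Measure.map_apply measurable_fst MeasurableSet.univ] at h1
    exact ⟨h1⟩
  have hle : quadraticCost (μ.map fun x => (x, r x)) ≤ quadraticCost γ := by
    rw [hcost]
    exact iInf₂_le γ ⟨hprob, hfst, hsnd⟩
  have hold : quadraticCost (μ.map fun x => (x, r x)) = ∫⁻ x, ‖x - r x‖ₑ ^ 2 ∂ρ +
      ∫⁻ p, (‖p.1 - r p.1‖ₑ ^ 2 + ‖p.2 - r p.2‖ₑ ^ 2) ∂κ := by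
    rw [quadraticCost_map (by fun_prop), ← hμ, lintegral_add_measure, lintegral_add_measure,
      lintegral_map (by fun_prop) measurable_fst, lintegral_map (by fun_prop) measurable_snd,
      lintegral_add_left (by fun_prop)]
  have hnew : quadraticCost γ = ∫⁻ x, ‖x - r x‖ₑ ^ 2 ∂ρ +
      ∫⁻ p, (‖p.1 - r p.2‖ₑ ^ 2 + ‖p.2 - r p.1‖ₑ ^ 2) ∂κ := by
    rw [lintegral_add_left (by fun_prop)]
    change ∫⁻ _, _ ∂(_ + (_ + _)) = _
    rw [lintegral_add_measure, lintegral_add_measure,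
      lintegral_map (by fun_prop) (by fun_prop), lintegral_map (by fun_prop) (by fun_prop),
      lintegral_map (by fun_prop) (by fun_prop)]
  -- Finiteness allows the unchanged cost to be cancelled in `ℝ≥0∞`.
  have hρ : ∫⁻ x, ‖x - r x‖ₑ ^ 2 ∂ρ ≠ ∞ :=
    ne_top_of_le_ne_top hfin (hold ▸ le_self_add)
  rw [hold, hnew] at hle
  exact (ENNReal.add_le_add_iff_left hρ).1 hle

lemma IsOptimalMap.congr_ae {r' : EuclideanSpace ℝ (Fin d) → EuclideanSpace ℝ (Fin d)}
    (hr : IsOptimalMap μ ν r) (h : r =ᵐ[μ] r') : IsOptimalMap μ ν r' := by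
  obtain ⟨hm, hmap, hplan⟩ := hr
  refine ⟨hm.congr h, by rw [← hmap, Measure.map_congr h], ?_⟩
  rwa [← Measure.map_congr (h.mono fun x hx => by simp only [hx] :
    (fun x => (x, r x)) =ᵐ[μ] fun x => (x, r' x))]

/-- Both marginals of `κ` are dominated by `μ`, so passing to a measurable representative of `r`
changes neither integral. -/
lemma IsOptimalMap.lintegral_le_lintegral_swap [IsProbabilityMeasure μ]
    (hr : IsOptimalMap μ ν r) (hfin : quadraticCost (μ.map fun x => (x, r x)) ≠ ∞)
    {κ : Measure (EuclideanSpace ℝ (Fin d) × EuclideanSpace ℝ (Fin d))} [IsFiniteMeasure κ]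
    (hκ : κ.map Prod.fst + κ.map Prod.snd ≤ μ) :
    ∫⁻ p, (‖p.1 - r p.1‖ₑ ^ 2 + ‖p.2 - r p.2‖ₑ ^ 2) ∂κ ≤
      ∫⁻ p, (‖p.1 - r p.2‖ₑ ^ 2 + ‖p.2 - r p.1‖ₑ ^ 2) ∂κ := by
  have hae := hr.1.ae_eq_mk
  have hfin' : quadraticCost (μ.map fun x => (x, hr.1.mk r x)) ≠ ∞ := by
    rwa [← Measure.map_congr (hae.mono fun x hx => by simp only [← hx] :
      (fun x => (x, r x)) =ᵐ[μ] fun x => (x, hr.1.mk r x))]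
  have h1 : ∀ᵐ p ∂κ, r p.1 = hr.1.mk r p.1 :=
    ae_of_ae_map measurable_fst.aemeasurable
      (hae.filter_mono (ae_mono ((Measure.le_add_right le_rfl).trans hκ)))
  have h2 : ∀ᵐ p ∂κ, r p.2 = hr.1.mk r p.2 :=
    ae_of_ae_map measurable_snd.aemeasurable
      (hae.filter_mono (ae_mono ((Measure.le_add_left le_rfl).trans hκ)))
  have key := (hr.congr_ae hae).lintegral_le_lintegral_swap_of_measurable
    hr.1.measurable_mk hfin' hκ
  calc _ = _ := lintegral_congr_ae (by filter_upwards [h1, h2] with p hp hq; rw [hp, hq])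
    _ ≤ _ := key
    _ = _ := lintegral_congr_ae (by filter_upwards [h1, h2] with p hp hq; rw [hp, hq])

/-- Expanding the squares, the left side minus the right is `2 ⟨x - y, u - v⟩`. -/
lemma enorm_sq_add_enorm_sq_lt_of_inner_neg {E : Type*} [NormedAddCommGroup E]
    [InnerProductSpace ℝ E] {x y u v : E} (h : inner ℝ (x - y) (u - v) < 0) :
    ‖x - v‖ₑ ^ 2 + ‖y - u‖ₑ ^ 2 < ‖x - u‖ₑ ^ 2 + ‖y - v‖ₑ ^ 2 := by
  have key : ‖x - v‖ ^ 2 + ‖y - u‖ ^ 2 < ‖x - u‖ ^ 2 + ‖y - v‖ ^ 2 := by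
    simp only [inner_sub_left, inner_sub_right] at h
    simp only [norm_sub_sq_real]
    linarith
  simp only [← ofReal_norm, ← ENNReal.ofReal_pow (norm_nonneg _)]
  rw [← ENNReal.ofReal_add (by positivity) (by positivity),
    ← ENNReal.ofReal_add (by positivity) (by positivity)]
  exact (ENNReal.ofReal_lt_ofReal_iff_of_nonneg (by positivity)).2 key

/-- An optimal map is monotone on every open subset of the support on which it is continuous. -/
lemma IsOptimalMap.inner_sub_nonneg [IsProbabilityMeasure μ]
    (hr : IsOptimalMap μ ν r) (hfin : quadraticCost (μ.map fun x => (x, r x)) ≠ ∞)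
    {U : Set (EuclideanSpace ℝ (Fin d))} (hU : IsOpen U) (hsupp : U ⊆ μ.support)
    (hcont : ContinuousOn r U) {z w : EuclideanSpace ℝ (Fin d)} (hz : z ∈ U) (hw : w ∈ U) :
    0 ≤ inner ℝ (z - w) (r z - r w) := by
  by_contra! hneg
  have hcz : ContinuousAt r z := hcont.continuousAt (hU.mem_nhds hz)
  have hcw : ContinuousAt r w := hcont.continuousAt (hU.mem_nhds hw)
  have hc : ContinuousAt (fun p : EuclideanSpace ℝ (Fin d) × EuclideanSpace ℝ (Fin d) =>
      (inner ℝ (p.1 - p.2) (r p.1 - r p.2) : ℝ)) (z, w) := by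
    have h1 : ContinuousAt (fun p : EuclideanSpace ℝ (Fin d) × EuclideanSpace ℝ (Fin d) =>
      r p.1) (z, w) := ContinuousAt.comp (f := Prod.fst) hcz continuousAt_fst
    have h2 : ContinuousAt (fun p : EuclideanSpace ℝ (Fin d) × EuclideanSpace ℝ (Fin d) =>
      r p.2) (z, w) := ContinuousAt.comp (f := Prod.snd) hcw continuousAt_snd
    exact (continuousAt_fst.sub continuousAt_snd).inner (𝕜 := ℝ) (h1.sub h2)
  have hev := hc.eventually (gt_mem_nhds hneg)
  obtain ⟨B, C, hB, hzB, hC, hwC, hBC⟩ := mem_nhds_prod_iff'.1 hev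
  -- The inner product is zero on the diagonal, so `B ×ˢ C` misses it. Disjointness is what fits
  -- both marginals of `κ` under `μ`.
  have hdisj : Disjoint B C := by
    rw [Set.disjoint_left]
    intro x hxB hxC
    have : inner ℝ (x - x) (r x - r x) < (0 : ℝ) := hBC (mk_mem_prod hxB hxC)
    simp at this
  have hBpos : 0 < μ B := Measure.mem_support_iff_forall z |>.1 (hsupp hz) B (hB.mem_nhds hzB)
  have hCpos : 0 < μ C := Measure.mem_support_iff_forall w |>.1 (hsupp hw) C (hC.mem_nhds hwC)
  -- The marginals are `μ C • μ.restrict B` and `μ B • μ.restrict C`; since `μ` has mass one, no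
  -- normalization is needed.
  let κ := (μ.restrict B).prod (μ.restrict C)
  have hκ : κ.map Prod.fst + κ.map Prod.snd ≤ μ := by
    calc κ.map Prod.fst + κ.map Prod.snd
        = μ C • μ.restrict B + μ B • μ.restrict C := by simp [κ]
      _ ≤ (1 : ℝ≥0∞) • μ.restrict B + (1 : ℝ≥0∞) • μ.restrict C := by
        gcongr
        · exact prob_le_one
        · exact prob_le_one
      _ = μ.restrict (B ∪ C) := by
        rw [one_smul, one_smul, Measure.restrict_union hdisj hC.measurableSet]
      _ ≤ μ := Measure.restrict_le_self
  have hlt : ∀ᵐ p ∂κ, ‖p.1 - r p.2‖ₑ ^ 2 + ‖p.2 - r p.1‖ₑ ^ 2 <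
      ‖p.1 - r p.1‖ₑ ^ 2 + ‖p.2 - r p.2‖ₑ ^ 2 := by
    have hmem : ∀ᵐ p ∂κ, p ∈ B ×ˢ C := by
      have : κ = (μ.prod μ).restrict (B ×ˢ C) := Measure.prod_restrict B C
      rw [this]
      exact ae_restrict_mem (hB.measurableSet.prod hC.measurableSet)
    filter_upwards [hmem] with p hp
    exact enorm_sq_add_enorm_sq_lt_of_inner_neg (hBC hp)
  have hm1 : AEMeasurable (fun p : EuclideanSpace ℝ (Fin d) × EuclideanSpace ℝ (Fin d) =>
      r p.1) κ := (hr.1.mono_measure Measure.restrict_le_self).comp_fst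
  have hm2 : AEMeasurable (fun p : EuclideanSpace ℝ (Fin d) × EuclideanSpace ℝ (Fin d) =>
      r p.2) κ := (hr.1.mono_measure Measure.restrict_le_self).comp_snd
  have hf1 : AEMeasurable (fun p : EuclideanSpace ℝ (Fin d) × EuclideanSpace ℝ (Fin d) =>
      ‖p.1 - r p.1‖ₑ ^ 2) κ := (measurable_fst.aemeasurable.sub hm1).enorm.pow_const 2
  have hf2 : AEMeasurable (fun p : EuclideanSpace ℝ (Fin d) × EuclideanSpace ℝ (Fin d) =>
      ‖p.1 - r p.1‖ₑ ^ 2 + ‖p.2 - r p.2‖ₑ ^ 2) κ :=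
    hf1.add ((measurable_snd.aemeasurable.sub hm2).enorm.pow_const 2)
  have hκ0 : κ ≠ 0 := by
    intro h0
    have : κ univ = μ B * μ C := by
      rw [← univ_prod_univ, Measure.prod_prod]; simp
    rw [h0] at this
    exact (ENNReal.mul_pos hBpos.ne' hCpos.ne').ne this
  have hold : ∫⁻ p, (‖p.1 - r p.1‖ₑ ^ 2 + ‖p.2 - r p.2‖ₑ ^ 2) ∂κ ≠ ∞ := by
    rw [lintegral_add_left' hf1]
    exact ENNReal.add_ne_top.2
      ⟨lintegral_displacement_ne_top hr.1 hfin measurable_fst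
        ((Measure.le_add_right le_rfl).trans hκ),
      lintegral_displacement_ne_top hr.1 hfin measurable_snd
        ((Measure.le_add_left le_rfl).trans hκ)⟩
  -- A strict pointwise inequality integrates to a strict one only if the smaller integral is
  -- finite.
  have hnew := ne_top_of_le_ne_top hold (lintegral_mono_ae (hlt.mono fun _ h => h.le))
  exact (lintegral_strict_mono hκ0 hf2 hnew hlt).not_ge
    (hr.lintegral_le_lintegral_swap hfin hκ)

end Swap

/-! ### Frame bounds and spanning from non-concentration on hyperplanes -/

section Frame

variable {d : ℕ} {μ : Measure (EuclideanSpace ℝ (Fin d))}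

lemma integrable_inner_sq (h2 : MemLp (fun y => y) 2 μ) (x : EuclideanSpace ℝ (Fin d)) :
    Integrable (fun y => (inner ℝ x y : ℝ) ^ 2) μ :=
  (h2.const_inner x).integrable_sq

/-- The quadratic form is continuous and positive on the compact unit sphere, so it has a positive
minimum there; homogeneity extends the bound. -/
lemma exists_pos_forall_le_integral_inner_sq (h2 : MemLp (fun y => y) 2 μ)
    (hne : ∀ x : EuclideanSpace ℝ (Fin d), x ≠ 0 → ¬ ∀ᵐ y ∂μ, (inner ℝ x y : ℝ) = 0) :
    ∃ A : ℝ, 0 < A ∧ ∀ x : EuclideanSpace ℝ (Fin d),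
      A * ‖x‖ ^ 2 ≤ ∫ y, (inner ℝ x y : ℝ) ^ 2 ∂μ := by
  set S := Metric.sphere (0 : EuclideanSpace ℝ (Fin d)) 1
  have hcont : ContinuousOn (fun x : EuclideanSpace ℝ (Fin d) =>
      ∫ y, (inner ℝ x y : ℝ) ^ 2 ∂μ) S := by
    refine continuousOn_of_dominated (bound := fun y => ‖y‖ ^ 2)
      (fun x _ => (integrable_inner_sq h2 x).aestronglyMeasurable) (fun x hx => ?_)
      ((memLp_two_iff_integrable_sq_norm h2.1).1 h2) (ae_of_all _ fun y => by fun_prop)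
    refine ae_of_all _ fun y => ?_
    have hx1 : ‖x‖ = 1 := by simpa [S] using hx
    have := abs_real_inner_le_norm x y
    rw [hx1, one_mul] at this
    rw [Real.norm_eq_abs, abs_pow]
    gcongr
  have hpos : ∀ x ∈ S, 0 < ∫ y, (inner ℝ x y : ℝ) ^ 2 ∂μ := by
    intro x hx
    have hx0 : x ≠ 0 := by rintro rfl; simp [S] at hx
    refine (integral_nonneg fun y => sq_nonneg _).lt_of_ne fun h0 => hne x hx0 ?_
    have := (integral_eq_zero_iff_of_nonneg (fun y => sq_nonneg _)
      (integrable_inner_sq h2 x)).1 h0.symm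
    filter_upwards [this] with y hy
    simpa using hy
  obtain ⟨A, hA, hAS⟩ : ∃ A : ℝ, 0 < A ∧ ∀ x ∈ S, A ≤ ∫ y, (inner ℝ x y : ℝ) ^ 2 ∂μ := by
    rcases S.eq_empty_or_nonempty with hS | hS
    -- The sphere is empty when `d = 0`.
    · exact ⟨1, one_pos, by simp [hS]⟩
    · obtain ⟨x, hx, hmin⟩ := (isCompact_sphere _ _).exists_isMinOn hS hcont
      exact ⟨_, hpos x hx, fun y hy => hmin hy⟩
  refine ⟨A, hA, fun x => ?_⟩
  rcases eq_or_ne x 0 with rfl | hx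
  · simp
  have hn : ‖x‖ ≠ 0 := norm_ne_zero_iff.2 hx
  have h := hAS (‖x‖⁻¹ • x) (by simp [S, norm_smul, hn])
  simp only [real_inner_smul_left, mul_pow] at h
  rw [integral_const_mul, inv_pow, le_inv_mul_iff₀ (by positivity)] at h
  linarith

lemma integral_inner_sq_le (h2 : MemLp (fun y => y) 2 μ) (x : EuclideanSpace ℝ (Fin d)) :
    ∫ y, (inner ℝ x y : ℝ) ^ 2 ∂μ ≤ (∫ y, ‖y‖ ^ 2 ∂μ) * ‖x‖ ^ 2 := by
  rw [mul_comm, ← integral_const_mul]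
  refine integral_mono (integrable_inner_sq h2 x)
    (((memLp_two_iff_integrable_sq_norm h2.1).1 h2).const_mul _) fun y => ?_
  have := pow_le_pow_left₀ (abs_nonneg _) (abs_real_inner_le_norm x y) 2
  rwa [sq_abs, mul_pow] at this

/-- A probability measure with finite second moment that is not carried by a hyperplane through
the origin is a probabilistic frame. -/
lemma isProbabilisticFrame_of_not_ae_inner_eq_zero [IsProbabilityMeasure μ]
    (h2 : MemLp (fun y => y) 2 μ)
    (hne : ∀ x : EuclideanSpace ℝ (Fin d), x ≠ 0 → ¬ ∀ᵐ y ∂μ, (inner ℝ x y : ℝ) = 0) :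
    IsProbabilisticFrame μ := by
  obtain ⟨A, hA, hle⟩ := exists_pos_forall_le_integral_inner_sq h2 hne
  -- The second moment is the upper bound; the `max` secures `A ≤ B` even for `d = 0`, where that
  -- moment is zero.
  refine ⟨inferInstance, A, max A (∫ y, ‖y‖ ^ 2 ∂μ), hA, le_max_left _ _, fun x => ?_⟩
  rw [← ofReal_integral_eq_lintegral_ofReal (integrable_inner_sq h2 x)
    (ae_of_all _ fun y => sq_nonneg _)]
  refine ⟨ENNReal.ofReal_le_ofReal (hle x), ENNReal.ofReal_le_ofReal ?_⟩
  refine (integral_inner_sq_le h2 x).trans ?_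
  gcongr
  exact le_max_right _ _

/-- The support has full measure, so a nonzero vector orthogonal to its span would be orthogonal to
almost every point. -/
lemma span_support_eq_top_of_not_ae_inner_eq_zero
    (hne : ∀ x : EuclideanSpace ℝ (Fin d), x ≠ 0 → ¬ ∀ᵐ y ∂μ, (inner ℝ x y : ℝ) = 0) :
    Submodule.span ℝ μ.support = ⊤ := by
  rw [← Submodule.orthogonal_eq_bot_iff, Submodule.eq_bot_iff]
  intro x hx
  by_contra hx0
  refine hne x hx0 ?_
  filter_upwards [Measure.support_mem_ae (μ := μ)] with y hy
  exact Submodule.inner_left_of_mem_orthogonal (Submodule.subset_span hy) hx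

end Frame

/-! ### Non-concentration along the geodesic -/

section Geodesic

variable {d : ℕ} {μ ν : Measure (EuclideanSpace ℝ (Fin d))}
  {r : EuclideanSpace ℝ (Fin d) → EuclideanSpace ℝ (Fin d)}

lemma not_ae_inner_eq_zero_of_absolutelyContinuous [NeZero μ] (h : μ ≪ volume)
    {x : EuclideanSpace ℝ (Fin d)} (hx : x ≠ 0) : ¬ ∀ᵐ y ∂μ, (inner ℝ x y : ℝ) = 0 := by
  intro hae
  have hne : (ℝ ∙ x)ᗮ ≠ ⊤ := by
    rw [Ne, Submodule.orthogonal_eq_top_iff, Submodule.span_singleton_eq_bot]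
    exact hx
  have h0 : μ ((ℝ ∙ x)ᗮ : Submodule ℝ (EuclideanSpace ℝ (Fin d))) = 0 :=
    h (Measure.addHaar_submodule _ _ hne)
  have hF : ∀ᵐ y ∂μ, False := by
    filter_upwards [hae, measure_eq_zero_iff_ae_notMem.1 h0] with y hy hy'
    exact hy' (Submodule.mem_orthogonal_singleton_iff_inner_right.2 hy)
  simp [NeZero.ne μ] at hF

/-- For `t < 1`, `h_t` does not map almost every point into a hyperplane through the origin:
otherwise `r` would be decreasing along its normal, against monotonicity. -/
lemma IsOptimalMap.not_ae_inner_interpMap_eq_zero [IsProbabilityMeasure μ]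
    (hr : IsOptimalMap μ ν r) (hfin : quadraticCost (μ.map fun x => (x, r x)) ≠ ∞)
    {U : Set (EuclideanSpace ℝ (Fin d))} (hU : IsOpen U) (hne : U.Nonempty)
    (hsupp : U ⊆ μ.support) (hcont : ContinuousOn r U) {t : ℝ} (ht0 : 0 ≤ t) (ht1 : t < 1)
    {x : EuclideanSpace ℝ (Fin d)} (hx : x ≠ 0) :
    ¬ ∀ᵐ z ∂μ, (inner ℝ x (interpMap r t z) : ℝ) = 0 := by
  intro hae
  have hcont' : ContinuousOn (fun z => (inner ℝ x (interpMap r t z) : ℝ)) U := by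
    unfold interpMap
    fun_prop
  -- A nonzero value would persist on a neighbourhood of `z`, which has positive measure because `z`
  -- lies in the support.
  have hzero : ∀ z ∈ U, (inner ℝ x (interpMap r t z) : ℝ) = 0 := by
    intro z hz
    by_contra hz0
    have hV : U ∩ (fun z => (inner ℝ x (interpMap r t z) : ℝ)) ⁻¹' {0}ᶜ ∈ nhds z :=
      (hcont'.isOpen_inter_preimage hU isOpen_compl_singleton).mem_nhds ⟨hz, hz0⟩
    refine (Measure.mem_support_iff_forall z |>.1 (hsupp hz) _ hV).ne' ?_
    exact measure_mono_null (fun y hy => hy.2) hae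
  obtain ⟨w, hw⟩ := hne
  obtain ⟨s, hs, hsU⟩ : ∃ s : ℝ, 0 < s ∧ w + s • x ∈ U := by
    have hc : Filter.Tendsto (fun s : ℝ => w + s • x) (nhdsWithin 0 (Ioi 0)) (nhds w) := by
      have : ContinuousAt (fun s : ℝ => w + s • x) 0 := by fun_prop
      simpa using this.tendsto.mono_left nhdsWithin_le_nhds
    obtain ⟨s, hsU, hs⟩ := ((hc.eventually_mem (hU.mem_nhds hw)).and self_mem_nhdsWithin).exists
    exact ⟨s, hs, hsU⟩
  have hmono := hr.inner_sub_nonneg hfin hU hsupp hcont hsU hw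
  have hz := hzero _ hsU
  have hw0 := hzero _ hw
  rw [add_sub_cancel_left, real_inner_smul_left, inner_sub_right] at hmono
  have hmono' := nonneg_of_mul_nonneg_right hmono hs
  simp only [interpMap, inner_add_right, inner_smul_right] at hz hw0
  have hxx : 0 < (inner ℝ x x : ℝ) := real_inner_self_pos.2 hx
  have h1 := mul_nonneg ht0 hmono'
  have h2 : 0 < (1 - t) * (s * inner ℝ x x) := by
    have := sub_pos.2 ht1
    positivity
  -- Subtracting `hw0` from `hz` gives `(1 - t) s ‖x‖² + t ⟨x, r (w + s • x) - r w⟩ = 0`, a positive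
  -- term plus a nonnegative one.
  linarith

lemma not_ae_inner_geodesicMeasure_eq_zero (hμ : IsRegularP2 μ) (hν : IsRegularP2 ν)
    (hr : IsOptimalMap μ ν r) (hfin : quadraticCost (μ.map fun x => (x, r x)) ≠ ∞)
    {U : Set (EuclideanSpace ℝ (Fin d))} (hU : IsOpen U) (hne : U.Nonempty)
    (hsupp : U ⊆ μ.support) (hcont : ContinuousOn r U) {t : ℝ} (ht : t ∈ Icc (0 : ℝ) 1)
    {x : EuclideanSpace ℝ (Fin d)} (hx : x ≠ 0) :
    ¬ ∀ᵐ y ∂geodesicMeasure μ r t, (inner ℝ x y : ℝ) = 0 := by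
  have := hμ.isProbabilityMeasure
  have := hν.isProbabilityMeasure
  have hrm := hr.1
  rcases ht.2.eq_or_lt with rfl | ht1
  · have h1 : interpMap r 1 = r := by ext1 z; simp [interpMap]
    rw [geodesicMeasure, h1, hr.2.1]
    exact not_ae_inner_eq_zero_of_absolutelyContinuous hν.absolutelyContinuous hx
  · intro hae
    exact hr.not_ae_inner_interpMap_eq_zero hfin hU hne hsupp hcont ht.1 ht1 hx
      (ae_of_ae_map (by unfold interpMap; fun_prop) hae)

end Geodesic

theorem mainTheorem1 {d : ℕ} (μ ν : Measure (EuclideanSpace ℝ (Fin d)))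
    (hμ : IsRegularP2 μ) (hν : IsRegularP2 ν)
    (r : EuclideanSpace ℝ (Fin d) → EuclideanSpace ℝ (Fin d))
    (hr : IsOptimalMap μ ν r)
    (N : Set (EuclideanSpace ℝ (Fin d))) (hN : μ N = 0)
    (hcont : ContinuousOn r (μ.support \ N))
    (hopen : ∃ U : Set (EuclideanSpace ℝ (Fin d)),
      IsOpen U ∧ U.Nonempty ∧ U ⊆ μ.support \ N)
    (t : ℝ) (ht : t ∈ Icc (0 : ℝ) 1) :
    IsProbabilisticFrame (geodesicMeasure μ r t) ∧
      Submodule.span ℝ (geodesicMeasure μ r t).support = ⊤ := by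
  have := hμ.isProbabilityMeasure
  obtain ⟨U, hU, hne, hsub⟩ := hopen
  -- The second moment of `r` under `μ` is that of `ν`.
  have hrLp : MemLp r 2 μ := by
    have h := hν.memLp_id
    rw [← hr.2.1] at h
    exact h.comp_of_map hr.1
  have hfin := quadraticCost_map_prodMk_ne_top hμ.memLp_id hrLp
  have hLp : MemLp (interpMap r t) 2 μ := (hμ.memLp_id.const_smul (1 - t)).add (hrLp.const_smul t)
  have hm : AEMeasurable (interpMap r t) μ := hLp.aestronglyMeasurable.aemeasurable
  have h2 : MemLp (fun y => y) 2 (geodesicMeasure μ r t) :=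
    (memLp_map_measure_iff aestronglyMeasurable_id hm).2 hLp
  have : IsProbabilityMeasure (geodesicMeasure μ r t) := Measure.isProbabilityMeasure_map hm
  have key : ∀ x : EuclideanSpace ℝ (Fin d), x ≠ 0 →
      ¬ ∀ᵐ y ∂geodesicMeasure μ r t, (inner ℝ x y : ℝ) = 0 := fun x hx =>
    not_ae_inner_geodesicMeasure_eq_zero hμ hν hr hfin hU hne (hsub.trans sdiff_subset)
      (hcont.mono hsub) ht hx
  exact ⟨isProbabilisticFrame_of_not_ae_inner_eq_zero h2 key,
    span_support_eq_top_of_not_ae_inner_eq_zero key⟩
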